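/- Let $(S_{g,n},d)$ be a complete hyperbolic surface of finite area with $n$ cusps $A_1,\dots,A_n$, with a fixed (canonical) horocycle at each cusp, let $T$ be an ideal geodesic triangulation of it with vertices at the cusps (loops, multiple edges and faces with two sides glued together are allowed), and let $r\in\mathbb R^n$. A semi-ideal prism is the convex hull in $\overline{\mathbb H}{}^3$ of an ideal triangle, with a horosphere at each of its vertices, and of its orthogonal projection to a plane (the lower plane) that the triangle does not meet, neither in $\mathbb H^3$ nor at infinity. The plane of the ideal triangle is the upper plane. A lateral edge joins an ideal vertex to its projection; its length is the signed distance from this projection to the horosphere at the vertex. The lengths of upper edges are the signed distances between the horospheres at their ends. A prismatic complex $K=K(T,r)$ consists of one semi-ideal prism for every face of $T$, such that the upper face of the prism is isometric to the face of $T$ as a decorated ideal triangle and the lateral edge at a vertex lying at the cusp $A_i$ has length $r_i$; the prisms are glued along their lateral faces, as the faces of $T$ are glued along their sides, by isometries that match vertices and horospheres. The complex $K$ is convex if at every edge of $T$ the sum of the dihedral angles of the two prisms meeting at this upper edge (the angles between the upper face and the lateral face) is at most $\pi$. Lemma. If $K(T,r)$ is a convex prismatic complex, then each prism of $K$ is ultraparallel: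 its upper plane and its lower plane have no common point in $\mathbb H^3$ and no common point at infinity. -/

import Mathlib

noncomputable section

namespace HypPrism

/-! ### The hyperboloid model -/

/-- The Minkowski space `ℝ^{1,n}`; coordinate `0` is the time coordinate. -/
abbrev Mink (n : ℕ) : Type := Fin (n + 1) → ℝ

/-- The scalar product `-x₀y₀ + x₁y₁ + ⋯ + xₙyₙ` of `ℝ^{1,n}`. -/
def mink {n : ℕ} (x y : Mink n) : ℝ := -(x 0 * y 0) + ∑ i : Fin n, x i.succ * y i.succ

/-- Hyperbolic space `ℍⁿ` as the upper sheet of the hyperboloid. -/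
def hyp (n : ℕ) : Set (Mink n) := {x | mink x x = -1 ∧ 0 < x 0}

/-- The future light cone. A vector `l` of it stands for the horosphere `{x ∈ ℍⁿ | ⟨l, x⟩ = -1}`,
and the ray spanned by `l` is the ideal point at which this horosphere is centred: a vector of the
light cone is the same thing as an ideal point equipped with a horosphere. -/
def lightCone (n : ℕ) : Set (Mink n) := {x | mink x x = 0 ∧ 0 < x 0}

/-- Isometries of `ℍⁿ`: linear maps that preserve the scalar product and the upper sheet. -/
def IsHypIsometry {n : ℕ} (g : Mink n ≃ₗ[ℝ] Mink n) : Prop :=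
  (∀ x y, mink (g x) (g y) = mink x y) ∧ ∀ x ∈ hyp n, g x ∈ hyp n

/-- Signed distance from a point `x` of `ℍⁿ` to the horosphere `l`: it is positive if `x` is outside
the horoball. -/
def distToHorosphere {n : ℕ} (x l : Mink n) : ℝ := Real.log (-mink x l)

/-- Signed distance between two horospheres (negative if they intersect), that is, the length of
the geodesic between two ideal points equipped with horospheres. -/
def horosphereDist {n : ℕ} (l l' : Mink n) : ℝ := Real.log (-mink l l' / 2)

/-- The component of `p` orthogonal to the plane of `ℝ^{1,n}` spanned by the independent light-like
vectors `a` and `b`. At every point of the geodesic `ab` of `ℍⁿ`, the orthogonal complement of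
`span (a, b)` is the space of tangent vectors normal to the geodesic, and the vector below points
into the half-plane that is bounded by the geodesic and contains `p`. -/
def normalPart {n : ℕ} (a b p : Mink n) : Mink n :=
  p - (mink p b / mink a b) • a - (mink p a / mink a b) • b

/-- The dihedral angle (in `[0, π]`) at the geodesic with ideal endpoints `a`, `b` between its two
half-planes that contain `p` and `q`: the angle between the corresponding normal vectors of
the geodesic. -/
def dihedralAngle {n : ℕ} (a b p q : Mink n) : ℝ :=
  Real.arccos (mink (normalPart a b p) (normalPart a b q) /
    (Real.sqrt (mink (normalPart a b p) (normalPart a b p)) *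
      Real.sqrt (mink (normalPart a b q) (normalPart a b q))))

/-! ### Hyperbolic cusp surfaces with canonical horocycles -/

/-- A complete oriented hyperbolic surface `ℍ² / Γ` of finite area with `n` cusps `A₁, …, Aₙ` and
a canonical horocycle at each cusp.

A vector `v` of the light cone projects to a cusp if and only if it is fixed by a nontrivial (then
parabolic) element of `Γ`. The vector `horo i` is a lift of the canonical horocycle at the `i`-th
cusp, so that `γ (horo i)`, `γ ∈ Γ`, are all the lifts. -/
structure CuspSurface (n : ℕ) where
  /-- the group of deck transformations -/
  Γ : Subgroup (Mink 2 ≃ₗ[ℝ] Mink 2)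
  isometry : ∀ γ ∈ Γ, IsHypIsometry γ
  orientation : ∀ γ ∈ Γ, LinearMap.det (γ : Mink 2 →ₗ[ℝ] Mink 2) = 1
  free : ∀ γ ∈ Γ, ∀ x ∈ hyp 2, γ x = x → γ = 1
  properlyDiscontinuous : ∀ C ⊆ hyp 2, IsCompact C → {γ | γ ∈ Γ ∧ ∃ x ∈ C, γ x ∈ C}.Finite
  /-- lifts of the canonical horocycles, one for each cusp -/
  horo : Fin n → Mink 2
  horo_mem : ∀ i, horo i ∈ lightCone 2
  horo_cusp : ∀ i, ∃ γ ∈ Γ, γ ≠ 1 ∧ γ (horo i) = horo i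
  /-- every cusp is one of the `Aᵢ` -/
  cusp_exhaust : ∀ v ∈ lightCone 2, (∃ γ ∈ Γ, γ ≠ 1 ∧ γ v = v) →
    ∃ i, ∃ γ ∈ Γ, ∃ c : ℝ, 0 < c ∧ v = c • γ (horo i)
  /-- the cusps `Aᵢ` are pairwise distinct -/
  cusp_distinct : ∀ i j, ∀ γ ∈ Γ, ∀ c : ℝ, 0 < c → γ (horo i) = c • horo j → i = j
  /-- finite area: outside the horodisks at the cusps the surface is compact -/
  finiteArea : ∃ C ⊆ hyp 2, IsCompact C ∧
    ∀ x ∈ hyp 2, ∃ γ ∈ Γ, γ x ∈ C ∨ ∃ i, -1 < mink (γ x) (horo i)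

/-- The closed ideal triangle of `ℍ²` with ideal vertices `v 0`, `v 1`, `v 2`. -/
def idealTriangle (v : Fin 3 → Mink 2) : Set (Mink 2) :=
  {x | x ∈ hyp 2 ∧ ∃ c : Fin 3 → ℝ, (∀ i, 0 ≤ c i) ∧ x = ∑ i, c i • v i}

/-- The interior of the ideal triangle with ideal vertices `v 0`, `v 1`, `v 2`. -/
def idealTriangleInterior (v : Fin 3 → Mink 2) : Set (Mink 2) :=
  {x | x ∈ hyp 2 ∧ ∃ c : Fin 3 → ℝ, (∀ i, 0 < c i) ∧ x = ∑ i, c i • v i}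

/-- An ideal geodesic triangulation of a cusp surface, with vertices at the cusps.

For each of the finitely many faces a lift to `ℍ²` is chosen; it has the vertices `vert f 0`,
`vert f 1`, `vert f 2`, which are lifts of the canonical horocycles. The translates of these
triangles by `Γ` tessellate `ℍ²` edge to edge. Loops, multiple edges, and faces with two
sides glued to each other are allowed. -/
structure IdealTriangulation {n : ℕ} (S : CuspSurface n) where
  /-- the number of faces -/
  numFaces : ℕ
  /-- the vertices of the chosen lift of a face, with horocycles -/
  vert : Fin numFaces → Fin 3 → Mink 2
  /-- the cusp at which a vertex of a face lies -/
  cusp : Fin numFaces → Fin 3 → Fin n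
  vert_cusp : ∀ f i, ∃ γ ∈ S.Γ, vert f i = γ (S.horo (cusp f i))
  nondegenerate : ∀ f, LinearIndependent ℝ (vert f)
  cover : ∀ x ∈ hyp 2, ∃ γ ∈ S.Γ, ∃ f, γ x ∈ idealTriangle (vert f)
  disjoint : ∀ f f', ∀ γ ∈ S.Γ, ∀ x ∈ idealTriangleInterior (vert f),
    γ x ∈ idealTriangleInterior (vert f') → γ = 1 ∧ f = f'
  /-- edge to edge: each (ordered) side of a triangle is a side of exactly one other triangle of
  the tessellation -/
  sides : ∀ f j k, j ≠ k →
    ∃! s : S.Γ × Fin numFaces × Fin 3 × Fin 3, s ≠ (1, f, j, k) ∧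
      (s.1 : Mink 2 ≃ₗ[ℝ] Mink 2) (vert s.2.1 s.2.2.1) = vert f j ∧
      (s.1 : Mink 2 ≃ₗ[ℝ] Mink 2) (vert s.2.1 s.2.2.2) = vert f k

/-- The side of `f` with the ends `j`, `k` is glued in the surface to the side of `f'` with the
ends `j'`, `k'`, where `j` is glued to `j'` and `k` to `k'`. -/
def IdealTriangulation.Glued {n : ℕ} {S : CuspSurface n} (T : IdealTriangulation S)
    (f : Fin T.numFaces) (j k : Fin 3) (f' : Fin T.numFaces) (j' k' : Fin 3) : Prop :=
  j ≠ k ∧ ∃ γ : S.Γ, (γ, f', j', k') ≠ (1, f, j, k) ∧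
    (γ : Mink 2 ≃ₗ[ℝ] Mink 2) (T.vert f' j') = T.vert f j ∧
    (γ : Mink 2 ≃ₗ[ℝ] Mink 2) (T.vert f' k') = T.vert f k

/-! ### Semi-ideal prisms -/

/-- A semi-ideal prism in `ℍ³`: the convex hull of an ideal triangle and of its orthogonal
projection to a plane that the triangle does not meet (neither in `ℍ³` nor at infinity). It is
determined by the three upper vertices, with their canonical horospheres, and by the lower plane
`{x ∈ ℍ³ | ⟨x, normal⟩ = 0}`, whose unit normal is taken on the side of the triangle. -/
structure SemiIdealPrism where
  /-- the upper vertices with their canonical horospheres -/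
  A : Fin 3 → Mink 3
  /-- the unit normal of the lower plane -/
  normal : Mink 3
  A_mem : ∀ i, A i ∈ lightCone 3
  nondegenerate : LinearIndependent ℝ A
  normal_unit : mink normal normal = 1
  above : ∀ i, 0 < mink (A i) normal

namespace SemiIdealPrism

/-- The lower vertex `Bᵢ`: the orthogonal projection of the ideal point `Aᵢ` to the lower plane,
i.e. the vector `Aᵢ - ⟨Aᵢ, normal⟩ normal` scaled to a point of `ℍ³`. -/
def B (P : SemiIdealPrism) (i : Fin 3) : Mink 3 :=
  (mink (P.A i) P.normal)⁻¹ • (P.A i - mink (P.A i) P.normal • P.normal)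

/-- The length of the lateral edge `AᵢBᵢ`. -/
def lateralLength (P : SemiIdealPrism) (i : Fin 3) : ℝ := distToHorosphere (P.B i) (P.A i)

/-- The length of the upper edge `AⱼAₖ`. -/
def upperLength (P : SemiIdealPrism) (j k : Fin 3) : ℝ := horosphereDist (P.A j) (P.A k)

/-- For pairwise distinct `i`, `j`, `k`: the dihedral angle of the prism at the upper edge `AⱼAₖ`,
that is, the angle between the upper face `AᵢAⱼAₖ` and the lateral face `AⱼAₖBₖBⱼ`. -/
def upperAngle (P : SemiIdealPrism) (i j k : Fin 3) : ℝ :=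
  dihedralAngle (P.A j) (P.A k) (P.A i) (P.B j)

/-- The prism is ultraparallel: the upper plane (the plane through the upper vertices) and the lower
plane have no common point, neither in `ℍ³` nor at infinity. -/
def IsUltraparallel (P : SemiIdealPrism) : Prop :=
  ∀ x ∈ hyp 3 ∪ lightCone 3, x ∈ Submodule.span ℝ (Set.range P.A) → mink x P.normal ≠ 0

end SemiIdealPrism

/-! ### Prismatic complexes -/

/-- The prismatic complex `K(T, r)`: to each face of `T` belongs a semi-ideal prism whose upper
face is isometric, as a decorated ideal triangle, to this face, and whose lateral edges have the
lengths given by `r`; whenever two sides of faces are glued in the surface, the lateral faces below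
them are glued by (the restriction of) an isometry that matches the vertices and the canonical
horospheres. Prisms and gluing maps are unique up to isometry, and they exist if and only if
the pair `(T, r)` is admissible. -/
structure PrismaticComplex {n : ℕ} {S : CuspSurface n} (T : IdealTriangulation S)
    (r : Fin n → ℝ) where
  prism : Fin T.numFaces → SemiIdealPrism
  upperLength_eq : ∀ f j k, j ≠ k →
    (prism f).upperLength j k = horosphereDist (T.vert f j) (T.vert f k)
  lateralLength_eq : ∀ f j, (prism f).lateralLength j = r (T.cusp f j)
  /-- the isometry that glues two lateral faces -/
  glue : ∀ f j k f' j' k', T.Glued f j k f' j' k' → (Mink 3 ≃ₗ[ℝ] Mink 3)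
  glue_isometry : ∀ f j k f' j' k' h, IsHypIsometry (glue f j k f' j' k' h)
  glue_upper : ∀ f j k f' j' k' h,
    glue f j k f' j' k' h ((prism f).A j) = (prism f').A j' ∧
    glue f j k f' j' k' h ((prism f).A k) = (prism f').A k'
  glue_lower : ∀ f j k f' j' k' h,
    glue f j k f' j' k' h ((prism f).B j) = (prism f').B j' ∧
    glue f j k f' j' k' h ((prism f).B k) = (prism f').B k'

/-- A complex is convex if the total dihedral angle at every upper edge, i.e. the sum of the
dihedral angles of the two prisms that meet there, is at most `π`. -/
def PrismaticComplex.IsConvex {n : ℕ} {S : CuspSurface n} {T : IdealTriangulation S}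
    {r : Fin n → ℝ} (K : PrismaticComplex T r) : Prop :=
  ∀ f i j k f' i' j' k', i ≠ j → i ≠ k → i' ≠ j' → i' ≠ k' → T.Glued f j k f' j' k' →
    (K.prism f).upperAngle i j k + (K.prism f').upperAngle i' j' k' ≤ Real.pi

end HypPrism

end

/-! Develop the upper boundary of `K` in the Minkowski space `ℝ^{1,2}`. The translates of the faces
of `T` span simplicial cones that tile the open future cone, and their vertices are light-like. On
the cone of a tile `a`, the products `⟨Aᵢ, normal⟩` at its vertices extend to a linear functional
`tileHeight a`. Under the isometry of the span of the `Aᵢ` with `ℝ^{1,2}` it is the product with the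
lower normal, so the prism is ultraparallel once this functional vanishes on no nonzero vector of
the closed future cone.

The functionals of adjacent tiles agree on the common wall. An angle sum of at most `π` says that
the slope does not increase across the wall (`height_le_of_cosExterior`), so together the
functionals form a locally concave function. Such a function is the minimum of its linear pieces
(`exists_tile_le`): at any `x` the functional of `a` is at least that of some tile containing `x`.

There are finitely many faces, so on its own cone each functional satisfies `h² ≥ δ(-⟨x,x⟩)` with a
common `δ > 0`; by concavity each one satisfies this on the whole future cone
(`exists_tileHeight_bound`). Hence it has no time-like zero. A light-like zero is also impossible,
since moving into the cone by `e` makes `h²` of order `e²` but `-⟨x,x⟩` of order `e`. -/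

open Filter Topology Module

namespace HypPrism

/-! ### Locally concave functions on tilings by simplicial cones -/

section Tiling

variable {E : Type*} [NormedAddCommGroup E] [NormedSpace ℝ E]

/-- A closed simplicial cone is in the closure of its interior. -/
theorem exists_coord_pos_of_nonneg (b : Basis (Fin 3) ℝ E) {z : E} (hz : ∀ i, 0 ≤ b.coord i z)
    {U : Set E} (hU : IsOpen U) (hzU : z ∈ U) : ∃ z' ∈ U, ∀ i, 0 < b.coord i z' := by
  have hc : ContinuousAt (fun e : ℝ => z + e • ∑ i, b i) 0 := by fun_prop
  have h0 : ∀ᶠ e : ℝ in 𝓝[>] 0, z + e • ∑ i, b i ∈ U :=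
    (hc.eventually (hU.mem_nhds (by simpa using hzU))).filter_mono nhdsWithin_le_nhds
  obtain ⟨e, he, he0⟩ := (h0.and self_mem_nhdsWithin).exists
  refine ⟨_, he, fun i => ?_⟩
  have : b.coord i (∑ i, b i) = 1 := by
    simp [map_sum, Finsupp.single_apply]
  rw [map_add, map_smul, this, smul_eq_mul, mul_one]
  exact add_pos_of_nonneg_of_pos (hz i) he0

theorem fin_three_cases {i j k : Fin 3} (hij : i ≠ j) (hik : i ≠ k) (hjk : j ≠ k) (l : Fin 3) :
    l = i ∨ l = j ∨ l = k := by
  revert i j k l; decide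

theorem sum_three {M : Type*} [AddCommMonoid M] {i j k : Fin 3} (hij : i ≠ j) (hik : i ≠ k)
    (hjk : j ≠ k) (g : Fin 3 → M) : ∑ l, g l = g i + g j + g k := by
  have : (Finset.univ : Finset (Fin 3)) = {i, j, k} := by
    revert i j k; decide
  rw [this, Finset.sum_insert (by simp [hij, hik]), Finset.sum_pair hjk, add_assoc]

theorem eq_coord_add (b : Basis (Fin 3) ℝ E) {i j k : Fin 3} (hij : i ≠ j) (hik : i ≠ k)
    (hjk : j ≠ k) (z : E) : z = b.coord i z • b i + b.coord j z • b j + b.coord k z • b k := by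
  conv_lhs => rw [← b.sum_repr z, sum_three hij hik hjk]
  rfl

variable [FiniteDimensional ℝ E]

theorem continuous_coord (b : Basis (Fin 3) ℝ E) (i : Fin 3) : Continuous (b.coord i) :=
  LinearMap.continuous_of_finiteDimensional _

theorem isOpen_coord_pos (b : Basis (Fin 3) ℝ E) (i : Fin 3) : IsOpen {z | 0 < b.coord i z} :=
  isOpen_lt continuous_const (continuous_coord b i)

theorem isOpen_all_coord_pos (b : Basis (Fin 3) ℝ E) : IsOpen {z | ∀ i, 0 < b.coord i z} := by
  simp only [Set.ofPred_forall]
  exact isOpen_iInter_of_finite fun i => isOpen_coord_pos b i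

variable {ι : Type*} {b : ι → Basis (Fin 3) ℝ E} {F : Set E}

/-- Two simplicial cones of a tiling that share a side lie on different sides of it. -/
theorem coord_neg_of_adjacent
    (hpos : ∀ a x, (∀ i, 0 < (b a).coord i x) → x ∈ F)
    (hdisj : ∀ a c, ∀ x ∈ F, (∀ i, 0 < (b a).coord i x) → (∀ i, 0 < (b c).coord i x) → a = c)
    {a c : ι} {i j k i' j' k' : Fin 3} (hij : i ≠ j) (hik : i ≠ k) (hjk : j ≠ k)
    (hij' : i' ≠ j') (hik' : i' ≠ k') (hjk' : j' ≠ k') (hac : c ≠ a)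
    (hj : b c j' = b a j) (hk : b c k' = b a k) : (b c).coord i' (b a i) < 0 := by
  by_contra! hneg
  have hi0 : (b c).coord i' (b a i) ≠ 0 := by
    intro h0
    have h1 := eq_coord_add (b c) hij' hik' hjk' (b a i)
    rw [h0, zero_smul, zero_add, hj, hk] at h1
    have h2 := congrArg ((b a).coord i) h1
    simp [hij.symm, hik.symm] at h2
  have hp : 0 < (b c).coord i' (b a i) := lt_of_le_of_ne hneg hi0.symm
  -- If both third vertices were on the same side, a point just off the common wall would be
  -- interior to both cones.
  have hc : Continuous fun e : ℝ => e • b a i + b a j + b a k := by fun_prop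
  have hU : IsOpen ({z | 0 < (b c).coord j' z} ∩ {z | 0 < (b c).coord k' z}) :=
    (isOpen_coord_pos _ _).inter (isOpen_coord_pos _ _)
  have h0 : ∀ᶠ e : ℝ in 𝓝[>] 0, e • b a i + b a j + b a k ∈
      ({z | 0 < (b c).coord j' z} ∩ {z | 0 < (b c).coord k' z}) := by
    refine (hc.continuousAt.eventually (hU.mem_nhds ?_)).filter_mono nhdsWithin_le_nhds
    rw [← hj, ← hk]
    simp [hjk', hjk'.symm]
  obtain ⟨e, he, he0⟩ := (h0.and self_mem_nhdsWithin).exists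
  have he0 : 0 < e := he0
  have ha : ∀ l, 0 < (b a).coord l (e • b a i + b a j + b a k) := by
    intro l
    rcases fin_three_cases hij hik hjk l with rfl | rfl | rfl
    · simp [hij.symm, hik.symm, he0]
    · simp [hij, hjk.symm]
    · simp [hik, hjk]
  refine hac (hdisj c a _ (hpos a _ ha) (fun l => ?_) ha)
  rcases fin_three_cases hij' hik' hjk' l with rfl | rfl | rfl
  · rw [map_add, map_add, map_smul, ← hj, ← hk]
    have := mul_pos he0 hp
    simpa [hij'.symm, hik'.symm] using this
  · exact he.1
  · exact he.2

/-- The local structure of a tiling by simplicial cones with a locally concave piecewise linear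
function: near a point of the cone `a`, there is one more cone `c` at most. -/
theorem local_structure {h : ι → E →ₗ[ℝ] ℝ}
    (hpos : ∀ a x, (∀ i, 0 < (b a).coord i x) → x ∈ F)
    (hdisj : ∀ a c, ∀ x ∈ F, (∀ i, 0 < (b a).coord i x) → (∀ i, 0 < (b c).coord i x) → a = c)
    (hedge : ∀ a, ∀ x ∈ F, ∀ i j, i ≠ j → (b a).coord i x = 0 → (b a).coord j x ≠ 0)
    (hadj : ∀ a i j k, i ≠ j → i ≠ k → j ≠ k → ∃ c i' j' k', i' ≠ j' ∧ i' ≠ k' ∧ j' ≠ k' ∧ c ≠ a ∧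
      b c j' = b a j ∧ b c k' = b a k ∧ h c (b c j') = h a (b a j) ∧ h c (b c k') = h a (b a k) ∧
      ((b c).coord i' (b a i) < 0 → h a (b a i) ≤ h c (b a i)))
    {a : ι} {x : E} (hx : x ∈ F) (hxa : ∀ i, 0 ≤ (b a).coord i x) :
    ∃ (c : ι) (m : E →ₗ[ℝ] ℝ) (U : Set E), IsOpen U ∧ x ∈ U ∧ m x = 0 ∧
      (∀ i, 0 ≤ (b c).coord i x) ∧
      (∀ z ∈ U, 0 ≤ m z → ∀ i, 0 ≤ (b a).coord i z) ∧
      (∀ z ∈ U, m z ≤ 0 → ∀ i, 0 ≤ (b c).coord i z) ∧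
      (∀ z, m z ≤ 0 → h c z ≤ h a z) ∧
      ∀ d, ∀ z ∈ U, (∀ i, 0 ≤ (b d).coord i z) → d = a ∨ d = c := by
  suffices H : ∃ (c : ι) (m : E →ₗ[ℝ] ℝ) (U : Set E), IsOpen U ∧ x ∈ U ∧ m x = 0 ∧
      (∀ z ∈ U, 0 ≤ m z → ∀ i, 0 ≤ (b a).coord i z) ∧
      (∀ z ∈ U, m z ≤ 0 → ∀ i, 0 ≤ (b c).coord i z) ∧
      (∀ z, m z ≤ 0 → h c z ≤ h a z) by
    obtain ⟨c, m, U, hU, hxU, hm, h1, h2, h3⟩ := H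
    refine ⟨c, m, U, hU, hxU, hm, h2 x hxU hm.le, h1, h2, h3, fun d z hz hd => ?_⟩
    -- The cones `a` and `c` fill `U`. An interior point of `d` near `z` therefore lies in one of
    -- them, and overlapping interiors force equality.
    obtain ⟨z', hz'U, hz'⟩ := exists_coord_pos_of_nonneg (b d) hd hU hz
    have key : ∀ e, (∀ i, 0 ≤ (b e).coord i z') → d = e := by
      intro e he
      obtain ⟨y, hy, hye⟩ := exists_coord_pos_of_nonneg (b e) he (isOpen_all_coord_pos (b d)) hz'
      exact hdisj d e y (hpos d y hy) hy hye
    rcases le_total 0 (m z') with hm' | hm'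
    · exact Or.inl (key a (h1 z' hz'U hm'))
    · exact Or.inr (key c (h2 z' hz'U hm'))
  -- At an interior point no wall is needed: `c = a` and `m = 0`. Otherwise exactly one coordinate
  -- vanishes, by `hedge`, and `m` is that coordinate.
  by_cases hint : ∀ i, 0 < (b a).coord i x
  · exact ⟨a, 0, _, isOpen_all_coord_pos (b a), hint, rfl, fun z hz _ i => (hz i).le,
      fun z hz _ i => (hz i).le, fun z _ => le_rfl⟩
  push Not at hint
  obtain ⟨i, hi⟩ := hint
  have hi : (b a).coord i x = 0 := le_antisymm hi (hxa i)
  obtain ⟨j, k, hij, hik, hjk⟩ : ∃ j k : Fin 3, i ≠ j ∧ i ≠ k ∧ j ≠ k := by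
    clear * -; revert i; decide
  have hj0 := lt_of_le_of_ne (hxa j) (hedge a x hx i j hij hi).symm
  have hk0 := lt_of_le_of_ne (hxa k) (hedge a x hx i k hik hi).symm
  obtain ⟨c, i', j', k', hij', hik', hjk', hca, hj, hk, hhj, hhk, hconc⟩ :=
    hadj a i j k hij hik hjk
  have hneg := coord_neg_of_adjacent hpos hdisj hij hik hjk hij' hik' hjk' hca hj hk
  have hx' := eq_coord_add (b a) hij hik hjk x
  rw [hi, zero_smul, zero_add, ← hj, ← hk] at hx'
  have hxj : (b c).coord j' x = (b a).coord j x := by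
    conv_lhs => rw [hx']
    simp [hjk'.symm]
  have hxk : (b c).coord k' x = (b a).coord k x := by
    conv_lhs => rw [hx']
    simp [hjk']
  refine ⟨c, (b a).coord i, {z | 0 < (b a).coord j z} ∩ {z | 0 < (b a).coord k z} ∩
    ({z | 0 < (b c).coord j' z} ∩ {z | 0 < (b c).coord k' z}), ?_, ?_, hi, ?_, ?_, ?_⟩
  · exact ((isOpen_coord_pos _ _).inter (isOpen_coord_pos _ _)).inter
      ((isOpen_coord_pos _ _).inter (isOpen_coord_pos _ _))
  · exact ⟨⟨hj0, hk0⟩, ⟨by rw [Set.mem_ofPred_eq, hxj]; exact hj0,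
      by rw [Set.mem_ofPred_eq, hxk]; exact hk0⟩⟩
  · rintro z ⟨⟨h1, h2⟩, -⟩ hz l
    rcases fin_three_cases hij hik hjk l with rfl | rfl | rfl
    exacts [hz, le_of_lt h1, le_of_lt h2]
  · rintro z ⟨-, ⟨h1, h2⟩⟩ hz l
    rcases fin_three_cases hij' hik' hjk' l with rfl | rfl | rfl
    · rw [eq_coord_add (b a) hij hik hjk z, map_add, map_add, map_smul, ← hj, ← hk]
      have := mul_nonneg_of_nonpos_of_nonpos hz hneg.le
      simpa [hij'.symm, hik'.symm] using this
    exacts [le_of_lt h1, le_of_lt h2]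
  · intro z hz
    -- The two functionals agree on the wall, so their difference is the coordinate at `i` times its
    -- value at `b a i`.
    have h1 := mul_le_mul_of_nonpos_left (hconc hneg) hz
    rw [eq_coord_add (b a) hij hik hjk z]
    rw [hj] at hhj
    rw [hk] at hhk
    simp only [map_add, map_smul, smul_eq_mul, hhj, hhk]
    linarith

/-- A locally concave piecewise linear function on a tiling by simplicial cones is the minimum of
its linear pieces. -/
theorem exists_tile_le {h : ι → E →ₗ[ℝ] ℝ} (hF : Convex ℝ F)
    (hcover : ∀ x ∈ F, ∃ a, ∀ i, 0 ≤ (b a).coord i x)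
    (hpos : ∀ a x, (∀ i, 0 < (b a).coord i x) → x ∈ F)
    (hdisj : ∀ a c, ∀ x ∈ F, (∀ i, 0 < (b a).coord i x) → (∀ i, 0 < (b c).coord i x) → a = c)
    (hedge : ∀ a, ∀ x ∈ F, ∀ i j, i ≠ j → (b a).coord i x = 0 → (b a).coord j x ≠ 0)
    (hadj : ∀ a i j k, i ≠ j → i ≠ k → j ≠ k → ∃ c i' j' k', i' ≠ j' ∧ i' ≠ k' ∧ j' ≠ k' ∧ c ≠ a ∧
      b c j' = b a j ∧ b c k' = b a k ∧ h c (b c j') = h a (b a j) ∧ h c (b c k') = h a (b a k) ∧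
      ((b c).coord i' (b a i) < 0 → h a (b a i) ≤ h c (b a i)))
    (a : ι) {x : E} (hx : x ∈ F) : ∃ c, (∀ i, 0 ≤ (b c).coord i x) ∧ h c x ≤ h a x := by
  have hloc := fun a x => local_structure (a := a) (x := x) hpos hdisj hedge hadj
  set y₀ : E := ∑ i, b a i
  have hy₀ : ∀ i, 0 < (b a).coord i y₀ := fun i => by
    simp [y₀, map_sum, Finsupp.single_apply]
  set y : ℝ → E := fun t => y₀ + t • (x - y₀) with hy
  have hyF : ∀ t ∈ Set.Icc (0 : ℝ) 1, y t ∈ F := fun t ht =>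
    hF.add_smul_sub_mem (hpos a _ hy₀) hx ht
  have hyc : Continuous y := by fun_prop
  have hlin : ∀ (m : E →ₗ[ℝ] ℝ) t s, m (y s) = m (y t) + (s - t) * m (x - y₀) := by
    intro m t s
    simp only [hy, map_add, map_smul, smul_eq_mul]
    ring
  -- Walk from the interior of `a` to `x`. The inequality is required at all later times, so that it
  -- survives every further crossing.
  let Q : Set ℝ := {t | t ∈ Set.Icc (0 : ℝ) 1 ∧ ∃ c, (∀ i, 0 ≤ (b c).coord i (y t)) ∧
    ∀ s, t ≤ s → h c (y s) ≤ h a (y s)}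
  have hQ0 : (0 : ℝ) ∈ Q := ⟨by simp, a, fun i => by simpa [hy] using (hy₀ i).le, fun s _ => le_rfl⟩
  have hbdd : BddAbove Q := ⟨1, fun t ht => ht.1.2⟩
  set τ := sSup Q
  have hτ : τ ∈ Set.Icc (0 : ℝ) 1 := ⟨le_csSup hbdd hQ0, csSup_le ⟨0, hQ0⟩ fun t ht => ht.1.2⟩
  -- Near `y τ` only `d` and `c` occur and both contain `y τ`, so the tile reached at a time just
  -- before `τ` contains `y τ` as well.
  have hτQ : τ ∈ Q := by
    obtain ⟨d, hd⟩ := hcover _ (hyF τ hτ)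
    obtain ⟨c, m, U, hU, hxU, hm, hc, -, -, -, huniq⟩ := hloc d _ (hyF τ hτ) hd
    obtain ⟨ε, hε, hball⟩ := Metric.isOpen_iff.1 (hU.preimage hyc) τ hxU
    obtain ⟨t, ht, htτ⟩ := exists_lt_of_lt_csSup ⟨0, hQ0⟩ (show τ - ε < sSup Q by linarith)
    have htle : t ≤ τ := le_csSup hbdd ht
    obtain ⟨ht01, e, he, hes⟩ := ht
    have htU : y t ∈ U := hball (by
      rw [Metric.mem_ball, Real.dist_eq, abs_lt]; constructor <;> linarith)
    refine ⟨hτ, e, ?_, fun s hs => hes s (htle.trans hs)⟩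
    rcases huniq e _ htU he with rfl | rfl
    exacts [hd, hc]
  have hτ1 : τ = 1 := by
    by_contra hne
    have hlt : τ < 1 := lt_of_le_of_ne hτ.2 hne
    obtain ⟨-, d, hd, hds⟩ := hτQ
    obtain ⟨c, m, U, hU, hxU, hm, hc, h1, h2, h3, -⟩ := hloc d _ (hyF τ hτ) hd
    obtain ⟨ε, hε, hball⟩ := Metric.isOpen_iff.1 (hU.preimage hyc) τ hxU
    obtain ⟨s, hs1, hs2⟩ := exists_between (lt_min hlt (show τ < τ + ε by linarith))
    have hsU : y s ∈ U := hball (by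
      rw [Metric.mem_ball, Real.dist_eq, abs_lt]
      have := hs2.trans_le (min_le_right _ _)
      constructor <;> linarith)
    have hs01 : s ∈ Set.Icc (0 : ℝ) 1 :=
      ⟨hτ.1.trans hs1.le, (hs2.trans_le (min_le_left _ _)).le⟩
    refine absurd (le_csSup hbdd (show s ∈ Q from ⟨hs01, ?_⟩)) (not_le.2 hs1)
    -- Either the segment stays in `d` for a while, or it passes to `c`. Since `m` is monotone along
    -- the segment, `h c ≤ h d` then holds from `τ` on.
    rcases le_total 0 (m (x - y₀)) with hd0 | hd0
    · refine ⟨d, h1 _ hsU ?_, fun u hu => hds u (hs1.le.trans hu)⟩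
      rw [hlin m τ s, hm, zero_add]
      exact mul_nonneg (by linarith) hd0
    · have hmu : ∀ u, τ ≤ u → m (y u) ≤ 0 := fun u hu => by
        rw [hlin m τ u, hm, zero_add]
        exact mul_nonpos_of_nonneg_of_nonpos (by linarith) hd0
      exact ⟨c, h2 _ hsU (hmu s hs1.le), fun u hu =>
        (h3 _ (hmu u (hs1.le.trans hu))).trans (hds u (hs1.le.trans hu))⟩
  have hy1 : y 1 = x := by simp [hy]
  obtain ⟨-, c, hc, hcs⟩ := hτQ
  rw [hτ1, hy1] at hc
  exact ⟨c, hc, by simpa [hy1] using hcs 1 hτ1.le⟩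

end Tiling

/-! ### Causal inequalities in Minkowski space and normal parts -/

section Minkowski

variable {n : ℕ}

theorem mink_comm (x y : Mink n) : mink x y = mink y x := by
  simp only [mink, mul_comm]

theorem mink_add_left (x y z : Mink n) : mink (x + y) z = mink x z + mink y z := by
  simp only [mink, Pi.add_apply, add_mul, Finset.sum_add_distrib]
  ring

theorem mink_smul_left (c : ℝ) (x y : Mink n) : mink (c • x) y = c * mink x y := by
  simp only [mink, Pi.smul_apply, smul_eq_mul, mul_assoc, ← Finset.mul_sum]
  ring

/-- The scalar product as a linear functional of the first vector. -/
noncomputable def minkL (y : Mink n) : Mink n →ₗ[ℝ] ℝ where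
  toFun x := mink x y
  map_add' x x' := mink_add_left x x' y
  map_smul' c x := mink_smul_left c x y

theorem mink_sub_left (x y z : Mink n) : mink (x - y) z = mink x z - mink y z :=
  map_sub (minkL z) x y

theorem mink_neg_left (x z : Mink n) : mink (-x) z = -mink x z :=
  map_neg (minkL z) x

theorem mink_zero_left (z : Mink n) : mink 0 z = 0 :=
  map_zero (minkL z)

theorem mink_sum_left {ι : Type*} (s : Finset ι) (g : ι → Mink n) (z : Mink n) :
    mink (∑ i ∈ s, g i) z = ∑ i ∈ s, mink (g i) z :=
  map_sum (minkL z) g s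

theorem mink_add_right (x y z : Mink n) : mink z (x + y) = mink z x + mink z y := by
  simp only [mink_comm z, mink_add_left]

theorem mink_sub_right (x y z : Mink n) : mink z (x - y) = mink z x - mink z y := by
  simp only [mink_comm z, mink_sub_left]

theorem mink_neg_right (x z : Mink n) : mink z (-x) = -mink z x := by
  simp only [mink_comm z, mink_neg_left]

theorem mink_smul_right (c : ℝ) (x y : Mink n) : mink x (c • y) = c * mink x y := by
  simp only [mink_comm x, mink_smul_left]

theorem mink_sum_right {ι : Type*} (s : Finset ι) (g : ι → Mink n) (z : Mink n) :
    mink z (∑ i ∈ s, g i) = ∑ i ∈ s, mink z (g i) := by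
  simp only [mink_comm z, mink_sum_left]

theorem mink_sum_smul_self (c : Fin 3 → ℝ) (v : Fin 3 → Mink n) :
    mink (∑ i, c i • v i) (∑ i, c i • v i) = ∑ i, ∑ j, c i * c j * mink (v i) (v j) := by
  simp only [mink_sum_left, mink_sum_right, mink_smul_left, mink_smul_right, mul_assoc]
  exact Finset.sum_congr rfl fun i _ => by
    rw [Finset.mul_sum]
    exact Finset.sum_congr rfl fun j _ => by rw [mink_comm]

theorem mink_self (x : Mink n) : mink x x = -(x 0) ^ 2 + ∑ i : Fin n, x i.succ ^ 2 := by
  simp only [mink, sq]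

/-- The open future cone. -/
def futureCone (n : ℕ) : Set (Mink n) := {x | mink x x < 0 ∧ 0 < x 0}

theorem mink_neg_of_future {x y : Mink n} (hx : mink x x ≤ 0) (hx0 : 0 < x 0)
    (hy : y ∈ futureCone n) : mink x y < 0 := by
  obtain ⟨hy, hy0⟩ := hy
  rw [mink_self] at hx hy
  have h := Finset.sum_mul_sq_le_sq_mul_sq Finset.univ (fun i : Fin n => x i.succ)
    (fun i => y i.succ)
  have hs : 0 ≤ ∑ i : Fin n, y i.succ ^ 2 := Finset.sum_nonneg fun i _ => sq_nonneg _
  have h1 : (∑ i : Fin n, x i.succ * y i.succ) ^ 2 < (x 0 * y 0) ^ 2 := by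
    refine h.trans_lt ?_
    rw [mul_pow]
    exact (mul_le_mul_of_nonneg_right (by linarith) hs).trans_lt
      (mul_lt_mul_of_pos_left (by linarith) (by positivity))
  have h2 := abs_lt_of_sq_lt_sq h1 (by positivity)
  simp only [mink]
  linarith [(abs_lt.1 h2).2]

theorem convex_futureCone : Convex ℝ (futureCone n) := by
  intro x hx y hy s t hs ht hst
  have hxy := mink_neg_of_future hx.1.le hx.2 hy
  have hx1 := hx.1
  have hx2 := hx.2
  have hy1 := hy.1
  have hy2 := hy.2
  rcases hs.eq_or_lt with rfl | hs
  · rw [zero_add] at hst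
    simpa [hst] using hy
  refine ⟨?_, ?_⟩
  · simp only [mink_add_left, mink_add_right, mink_smul_left, mink_smul_right, mink_comm y x]
    have h1 := mul_neg_of_pos_of_neg (mul_pos hs hs) hx1
    have h2 := mul_nonpos_of_nonneg_of_nonpos (mul_nonneg ht ht) hy1.le
    have h3 := mul_nonpos_of_nonneg_of_nonpos (mul_nonneg hs.le ht) hxy.le
    linarith
  · simp only [Pi.add_apply, Pi.smul_apply, smul_eq_mul]
    have h1 := mul_pos hs hx2
    have h2 := mul_nonneg ht hy2.le
    linarith

/-- For light-like vectors, `-2x₀y₀⟨x,y⟩` is the sum of the squares of `y₀xᵢ - x₀yᵢ`, which vanishes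
only for proportional vectors. -/
theorem mink_lightCone_neg {x y : Mink n} (hx : x ∈ lightCone n) (hy : y ∈ lightCone n)
    (hxy : ∀ c : ℝ, y ≠ c • x) : mink x y < 0 := by
  by_contra! hneg
  have h1 : ∑ i : Fin n, (y 0 * x i.succ - x 0 * y i.succ) ^ 2 = -2 * (x 0 * y 0) * mink x y := by
    have e : ∀ i : Fin n, (y 0 * x i.succ - x 0 * y i.succ) ^ 2 = y 0 ^ 2 * x i.succ ^ 2 +
      x 0 ^ 2 * y i.succ ^ 2 - 2 * (x 0 * y 0) * (x i.succ * y i.succ) := fun i => by ring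
    have hx1 := hx.1
    have hy1 := hy.1
    rw [mink_self] at hx1 hy1
    have hx2 : ∑ i : Fin n, x i.succ ^ 2 = x 0 ^ 2 := by linarith
    have hy2 : ∑ i : Fin n, y i.succ ^ 2 = y 0 ^ 2 := by linarith
    simp only [e, Finset.sum_sub_distrib, Finset.sum_add_distrib, ← Finset.mul_sum, hx2, hy2, mink]
    ring
  have hx0 := hx.2
  have hy0 := hy.2
  have h2 : ∑ i : Fin n, (y 0 * x i.succ - x 0 * y i.succ) ^ 2 = 0 := by
    refine le_antisymm ?_ (Finset.sum_nonneg fun i _ => sq_nonneg _)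
    rw [h1]
    have := mul_nonneg (mul_pos hx0 hy0).le hneg
    linarith
  have h3 := (Finset.sum_eq_zero_iff_of_nonneg fun i _ => sq_nonneg _).1 h2
  refine hxy (y 0 / x 0) (funext fun l => ?_)
  refine Fin.cases ?_ (fun i => ?_) l
  · simp [hx0.ne']
  · have := pow_eq_zero_iff two_ne_zero |>.1 (h3 i (Finset.mem_univ i))
    simp only [Pi.smul_apply, smul_eq_mul]
    field_simp
    linarith

theorem mink_neg_of_linearIndependent {v : Fin 3 → Mink n} (hv : ∀ i, v i ∈ lightCone n)
    (hli : LinearIndependent ℝ v) {i j : Fin 3} (hij : i ≠ j) : mink (v i) (v j) < 0 := by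
  refine mink_lightCone_neg (hv i) (hv j) fun c hc => ?_
  have h := hli.comp ![i, j] (by
    intro p q
    fin_cases p <;> fin_cases q <;> simp [hij, hij.symm])
  have e : v ∘ ![i, j] = ![v i, v j] := by
    ext p
    fin_cases p <;> rfl
  rw [e] at h
  have := LinearIndependent.pair_iff.1 h c (-1) (by simp [hc])
  norm_num at this

theorem mink_nonneg_of_orthogonal {t x : Mink n} (ht : mink t t < 0) (hx : mink x t = 0) :
    0 ≤ mink x x := by
  rw [mink_self] at ht ⊢
  simp only [mink] at hx
  have h := Finset.sum_mul_sq_le_sq_mul_sq Finset.univ (fun i : Fin n => x i.succ)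
    (fun i => t i.succ)
  have hs : 0 ≤ ∑ i : Fin n, x i.succ ^ 2 := Finset.sum_nonneg fun i _ => sq_nonneg _
  have hs' : 0 ≤ ∑ i : Fin n, t i.succ ^ 2 := Finset.sum_nonneg fun i _ => sq_nonneg _
  have e : ∑ i : Fin n, x i.succ * t i.succ = x 0 * t 0 := by linarith
  rw [e, mul_pow] at h
  have ht0 : 0 < t 0 ^ 2 := by linarith
  have h1 := h.trans (mul_le_mul_of_nonneg_left (show _ ≤ t 0 ^ 2 by linarith) hs)
  have := le_of_mul_le_mul_right h1 ht0
  linarith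

theorem mink_cauchy_schwarz {t x y : Mink n} (ht : mink t t < 0) (hx : mink x t = 0)
    (hy : mink y t = 0) : mink x y ^ 2 ≤ mink x x * mink y y := by
  have h : ∀ s : ℝ, 0 ≤ mink y y * (s * s) + 2 * mink x y * s + mink x x := by
    intro s
    have := mink_nonneg_of_orthogonal ht (x := x + s • y)
      (by rw [mink_add_left, mink_smul_left, hx, hy]; ring)
    simp only [mink_add_left, mink_add_right, mink_smul_left, mink_smul_right, mink_comm y x]
      at this
    linarith
  have := discrim_le_zero h
  rw [discrim] at this
  linarith

theorem mink_eq_zero_iff_of_nonpos {x : Mink n} (hx : mink x x ≤ 0) (h0 : x 0 = 0) : x = 0 := by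
  rw [mink_self, h0] at hx
  have hs : ∑ i : Fin n, x i.succ ^ 2 = 0 :=
    le_antisymm (by simpa using hx) (Finset.sum_nonneg fun i _ => sq_nonneg _)
  have h3 := (Finset.sum_eq_zero_iff_of_nonneg fun i _ => sq_nonneg _).1 hs
  refine funext fun l => Fin.cases h0 (fun i => ?_) l
  exact pow_eq_zero_iff two_ne_zero |>.1 (h3 i (Finset.mem_univ i))

theorem exists_mem_futureCone : ∃ o : Mink n, o ∈ futureCone n :=
  ⟨Pi.single 0 1, by simp [mink], by simp⟩

theorem exists_smul_mem_hyp {x : Mink n} (hx : x ∈ futureCone n) :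
    ∃ s : ℝ, 0 < s ∧ s • x ∈ hyp n := by
  have h : 0 < -mink x x := by linarith [hx.1]
  refine ⟨(Real.sqrt (-mink x x))⁻¹, by positivity, ?_, ?_⟩
  · rw [mink_smul_left, mink_smul_right, ← mul_assoc, ← mul_inv, Real.mul_self_sqrt h.le]
    have := h.ne'
    field_simp
    rw [div_self (neg_ne_zero.1 this)]
  · have := hx.2
    simp only [Pi.smul_apply, smul_eq_mul]
    positivity

theorem hyp_subset_futureCone : hyp n ⊆ futureCone n := fun x hx => ⟨by rw [hx.1]; norm_num, hx.2⟩

/-- Only the hyperboloid sheet is assumed to be preserved. The time orientation of `g x` is read off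
from its product with the image of a point of `ℍⁿ`. -/
theorem IsHypIsometry.map_lightCone {g : Mink n ≃ₗ[ℝ] Mink n} (hg : IsHypIsometry g) {x : Mink n}
    (hx : x ∈ lightCone n) : g x ∈ lightCone n := by
  have h0 : mink (g x) (g x) = 0 := by rw [hg.1, hx.1]
  refine ⟨h0, ?_⟩
  obtain ⟨o', ho'⟩ := exists_mem_futureCone (n := n)
  obtain ⟨s, hs, ho⟩ := exists_smul_mem_hyp ho'
  have h1 := mink_neg_of_future hx.1.le hx.2 (hyp_subset_futureCone ho)
  rw [← hg.1] at h1
  have h2 := hyp_subset_futureCone (hg.2 _ ho)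
  rcases lt_trichotomy (g x 0) 0 with h | h | h
  · have := mink_neg_of_future (x := -g x) (by rw [mink_neg_left, mink_neg_right, h0]; norm_num)
      (by simpa using h) h2
    rw [mink_neg_left] at this
    linarith
  · rw [mink_eq_zero_iff_of_nonpos h0.le h, mink_zero_left] at h1
    exact absurd h1 (lt_irrefl 0)
  · exact h

/-- Positive combinations of independent future light-like vectors are time-like. -/
theorem sum_smul_mem_futureCone {v : Fin 3 → Mink n} (hv : ∀ i, v i ∈ lightCone n)
    (hli : LinearIndependent ℝ v) {c : Fin 3 → ℝ} (hc : ∀ i, 0 < c i) :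
    ∑ i, c i • v i ∈ futureCone n := by
  constructor
  · rw [mink_sum_smul_self]
    have h := fun {i j : Fin 3} (hij : i ≠ j) => mul_neg_of_pos_of_neg (mul_pos (hc i) (hc j))
      (mink_neg_of_linearIndependent hv hli hij)
    have h01 := h (i := 0) (j := 1) (by decide)
    have h02 := h (i := 0) (j := 2) (by decide)
    have h12 := h (i := 1) (j := 2) (by decide)
    have h10 := h (i := 1) (j := 0) (by decide)
    have h20 := h (i := 2) (j := 0) (by decide)
    have h21 := h (i := 2) (j := 1) (by decide)
    simp only [Fin.sum_univ_three, (hv _).1, mul_zero]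
    linarith
  · simp only [Finset.sum_apply, Pi.smul_apply, smul_eq_mul]
    exact Finset.sum_pos (fun i _ => mul_pos (hc i) (hv i).2) Finset.univ_nonempty

theorem mink_normalPart_left {a b p x : Mink n} (ha : mink a x = 0) (hb : mink b x = 0) :
    mink (normalPart a b p) x = mink p x := by
  simp only [normalPart, mink_sub_left, mink_smul_left, ha, hb]
  ring

theorem mink_left_normalPart {a b : Mink n} (p : Mink n) (ha : mink a a = 0)
    (hab : mink a b ≠ 0) : mink a (normalPart a b p) = 0 := by
  simp only [normalPart, mink_sub_right, mink_smul_right, ha, mink_comm a p]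
  field_simp
  ring

theorem mink_right_normalPart {a b : Mink n} (p : Mink n) (hb : mink b b = 0)
    (hab : mink a b ≠ 0) : mink b (normalPart a b p) = 0 := by
  simp only [normalPart, mink_sub_right, mink_smul_right, hb, mink_comm b p, mink_comm b a]
  field_simp
  ring

theorem mink_normalPart_normalPart {a b : Mink n} (p q : Mink n) (ha : mink a a = 0)
    (hb : mink b b = 0) (hab : mink a b ≠ 0) :
    mink (normalPart a b p) (normalPart a b q) =
      mink p q - (mink p a * mink q b + mink p b * mink q a) / mink a b := by
  rw [mink_normalPart_left (mink_left_normalPart q ha hab) (mink_right_normalPart q hb hab)]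
  simp only [normalPart, mink_sub_right, mink_smul_right]
  field_simp
  ring

theorem normalPart_cauchy_schwarz {a b : Mink n} (p q : Mink n) (ha : mink a a = 0)
    (hb : mink b b = 0) (hab : mink a b < 0) :
    mink (normalPart a b p) (normalPart a b q) ^ 2 ≤
      mink (normalPart a b p) (normalPart a b p) * mink (normalPart a b q) (normalPart a b q) := by
  -- The vector `a + b` is time-like and orthogonal to all normal parts.
  refine mink_cauchy_schwarz (t := a + b) ?_ ?_ ?_
  · simp only [mink_add_left, mink_add_right, ha, hb, mink_comm b a]
    linarith
  all_goals
    rw [mink_comm, mink_add_left, mink_left_normalPart _ ha hab.ne,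
      mink_right_normalPart _ hb hab.ne, add_zero]

theorem add_nonneg_of_arccos_add_le {x y : ℝ} (hx : |x| ≤ 1) (hy : |y| ≤ 1)
    (h : Real.arccos x + Real.arccos y ≤ Real.pi) : 0 ≤ x + y := by
  rw [abs_le] at hx hy
  have h1 := Real.cos_le_cos_of_nonneg_of_le_pi (Real.arccos_nonneg y)
    (show Real.pi - Real.arccos x ≤ Real.pi by linarith [Real.arccos_nonneg x])
    (by linarith)
  rw [Real.cos_pi_sub, Real.cos_arccos hx.1 hx.2, Real.cos_arccos hy.1 hy.2] at h1
  linarith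

end Minkowski

section NormalPart

variable {n : ℕ}

theorem normalPart_sub (a b p q : Mink n) :
    normalPart a b (p - q) = normalPart a b p - normalPart a b q := by
  simp only [normalPart, mink_sub_left, sub_div, sub_smul]
  abel

theorem normalPart_add (a b p q : Mink n) :
    normalPart a b (p + q) = normalPart a b p + normalPart a b q := by
  simp only [normalPart, mink_add_left, add_div, add_smul]
  abel

theorem normalPart_smul (a b p : Mink n) (c : ℝ) :
    normalPart a b (c • p) = c • normalPart a b p := by
  simp only [normalPart, mink_smul_left, mul_div_assoc, mul_smul, smul_sub]

theorem normalPart_left {a b : Mink n} (ha : mink a a = 0) (hab : mink a b ≠ 0) :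
    normalPart a b a = 0 := by
  simp [normalPart, ha, div_self hab]

theorem normalPart_right {a b : Mink n} (hb : mink b b = 0) (hab : mink a b ≠ 0) :
    normalPart a b b = 0 := by
  simp [normalPart, hb, mink_comm b a, div_self hab]

end NormalPart

/-! ### Dihedral angles of a prism in terms of its heights -/

namespace SemiIdealPrism

variable (P : SemiIdealPrism)

/-- The hyperbolic sine of the signed distance to the lower plane, on the decorated vertices. -/
def height (i : Fin 3) : ℝ := mink (P.A i) P.normal

theorem height_pos (i : Fin 3) : 0 < P.height i := P.above i

theorem mink_A_neg {i j : Fin 3} (hij : i ≠ j) : mink (P.A i) (P.A j) < 0 :=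
  mink_neg_of_linearIndependent P.A_mem P.nondegenerate hij

/-- The lateral length is thus the logarithm of the height, and isometries that match the lateral
edges preserve heights. -/
theorem mink_B_A (i : Fin 3) : mink (P.B i) (P.A i) = -P.height i := by
  have h := (P.above i).ne'
  simp only [B, mink_smul_left, mink_sub_left, (P.A_mem i).1, mink_comm P.normal, height]
  field_simp
  ring

theorem normalPart_B {j k : Fin 3} (hjk : j ≠ k) :
    normalPart (P.A j) (P.A k) (P.B j) = -normalPart (P.A j) (P.A k) P.normal := by
  have h := (P.above j).ne'
  rw [B, normalPart_smul, normalPart_sub, normalPart_smul,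
    normalPart_left (P.A_mem j).1 (P.mink_A_neg hjk).ne, zero_sub, smul_neg, inv_smul_smul₀ h]

/-- The right-hand side is the height functional applied to the normal part of `Aᵢ`, which is its
slope across the edge. -/
theorem mink_normalPart_normal {i j k : Fin 3} (hjk : j ≠ k) :
    mink (normalPart (P.A j) (P.A k) (P.A i)) (normalPart (P.A j) (P.A k) P.normal) =
      P.height i - mink (P.A i) (P.A k) / mink (P.A j) (P.A k) * P.height j -
        mink (P.A i) (P.A j) / mink (P.A j) (P.A k) * P.height k := by
  rw [mink_normalPart_normalPart _ _ (P.A_mem j).1 (P.A_mem k).1 (P.mink_A_neg hjk).ne,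
    mink_comm P.normal, mink_comm P.normal]
  simp only [height]
  ring

/-- Only data of the edge `AⱼAₖ` enter, so two prisms glued along it have the same value. -/
theorem mink_normalPart_normal_self {j k : Fin 3} (hjk : j ≠ k) :
    mink (normalPart (P.A j) (P.A k) P.normal) (normalPart (P.A j) (P.A k) P.normal) =
      1 - 2 * P.height j * P.height k / mink (P.A j) (P.A k) := by
  rw [mink_normalPart_normalPart _ _ (P.A_mem j).1 (P.A_mem k).1 (P.mink_A_neg hjk).ne,
    mink_comm P.normal (P.A j), mink_comm P.normal (P.A k), P.normal_unit]
  simp only [height]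
  ring

theorem mink_normalPart_normal_self_pos {j k : Fin 3} (hjk : j ≠ k) :
    0 < mink (normalPart (P.A j) (P.A k) P.normal) (normalPart (P.A j) (P.A k) P.normal) := by
  rw [P.mink_normalPart_normal_self hjk]
  have h1 := div_neg_of_pos_of_neg (mul_pos (mul_pos two_pos (P.height_pos j)) (P.height_pos k))
    (P.mink_A_neg hjk)
  linarith

theorem mink_normalPart_A_pos {i j k : Fin 3} (hij : i ≠ j) (hik : i ≠ k) (hjk : j ≠ k) :
    0 < mink (normalPart (P.A j) (P.A k) (P.A i)) (normalPart (P.A j) (P.A k) (P.A i)) := by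
  rw [mink_normalPart_normalPart _ _ (P.A_mem j).1 (P.A_mem k).1 (P.mink_A_neg hjk).ne,
    (P.A_mem i).1, zero_sub, ← neg_div]
  have := mul_pos_of_neg_of_neg (P.mink_A_neg hij) (P.mink_A_neg hik)
  exact div_pos_of_neg_of_neg (by linarith) (P.mink_A_neg hjk)

/-- The cosine of the exterior dihedral angle at an upper edge. -/
noncomputable def cosExterior (i j k : Fin 3) : ℝ :=
  mink (normalPart (P.A j) (P.A k) (P.A i)) (normalPart (P.A j) (P.A k) P.normal) /
    (Real.sqrt (mink (normalPart (P.A j) (P.A k) (P.A i)) (normalPart (P.A j) (P.A k) (P.A i))) *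
      Real.sqrt (mink (normalPart (P.A j) (P.A k) P.normal) (normalPart (P.A j) (P.A k) P.normal)))

theorem upperAngle_eq {i j k : Fin 3} (hjk : j ≠ k) :
    P.upperAngle i j k = Real.arccos (-P.cosExterior i j k) := by
  rw [upperAngle, dihedralAngle, P.normalPart_B hjk, cosExterior, mink_neg_right, mink_neg_right,
    mink_neg_left, neg_neg, neg_div]

theorem abs_cosExterior_le {i j k : Fin 3} (hij : i ≠ j) (hik : i ≠ k) (hjk : j ≠ k) :
    |P.cosExterior i j k| ≤ 1 := by
  have h1 := P.mink_normalPart_A_pos hij hik hjk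
  have h2 := P.mink_normalPart_normal_self_pos hjk
  have h := normalPart_cauchy_schwarz (P.A i) P.normal (P.A_mem j).1 (P.A_mem k).1
    (P.mink_A_neg hjk)
  rw [cosExterior, abs_div, ← Real.sqrt_mul h1.le, abs_of_nonneg (Real.sqrt_nonneg _),
    div_le_one (Real.sqrt_pos.2 (mul_pos h1 h2))]
  exact Real.abs_le_sqrt h

theorem cosExterior_add_le {P P' : SemiIdealPrism} {i j k i' j' k' : Fin 3} (hij : i ≠ j)
    (hik : i ≠ k) (hjk : j ≠ k) (hij' : i' ≠ j') (hik' : i' ≠ k') (hjk' : j' ≠ k')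
    (h : P.upperAngle i j k + P'.upperAngle i' j' k' ≤ Real.pi) :
    P.cosExterior i j k + P'.cosExterior i' j' k' ≤ 0 := by
  rw [P.upperAngle_eq hjk, P'.upperAngle_eq hjk'] at h
  have := add_nonneg_of_arccos_add_le (by rw [abs_neg]; exact P.abs_cosExterior_le hij hik hjk)
    (by rw [abs_neg]; exact P'.abs_cosExterior_le hij' hik' hjk') h
  linarith

end SemiIdealPrism

/-- An angle condition between two prisms, translated to linear functionals on `ℝ^{1,2}`: in the
plane of development, the second functional is above the first one on the side of the first
triangle. -/
theorem height_le_of_cosExterior {P P' : SemiIdealPrism} {u u' : Fin 3 → Mink 2}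
    {h h' : Mink 2 →ₗ[ℝ] ℝ}
    (hu : ∀ i, mink (u i) (u i) = 0)
    (hG : ∀ i j, mink (P.A i) (P.A j) = mink (u i) (u j))
    (hG' : ∀ i j, mink (P'.A i) (P'.A j) = mink (u' i) (u' j))
    (hh : ∀ i, h (u i) = P.height i) (hh' : ∀ i, h' (u' i) = P'.height i)
    {i j k i' j' k' : Fin 3} (hjk : j ≠ k)
    (hij' : i' ≠ j') (hik' : i' ≠ k') (hjk' : j' ≠ k')
    (hj : u' j' = u j) (hk : u' k' = u k)
    (hhj : P'.height j' = P.height j) (hhk : P'.height k' = P.height k)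
    {μ β γ : ℝ} (hμ : μ < 0) (hi : u i = μ • u' i' + β • u' j' + γ • u' k')
    (hcos : P.cosExterior i j k + P'.cosExterior i' j' k' ≤ 0) : h (u i) ≤ h' (u i) := by
  have hab : mink (u j) (u k) < 0 := hG j k ▸ P.mink_A_neg hjk
  set p := normalPart (u j) (u k) (u i) with hp
  set p' := normalPart (u j) (u k) (u' i') with hp'
  have hpp' : p = μ • p' := by
    rw [hp, hi, hj, hk, normalPart_add, normalPart_add, normalPart_smul, normalPart_smul,
      normalPart_smul, normalPart_left (hu j) hab.ne, normalPart_right (hu k) hab.ne, smul_zero,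
      smul_zero, add_zero, add_zero]
  have hD : mink (normalPart (P.A j) (P.A k) (P.A i)) (normalPart (P.A j) (P.A k) P.normal) =
      h p := by
    rw [P.mink_normalPart_normal hjk]
    simp only [hp, normalPart, map_sub, map_smul, hh, hG, smul_eq_mul]
  have hD' : mink (normalPart (P'.A j') (P'.A k') (P'.A i'))
      (normalPart (P'.A j') (P'.A k') P'.normal) = h' p' := by
    rw [P'.mink_normalPart_normal hjk', hp', ← hj, ← hk]
    simp only [normalPart, map_sub, map_smul, hh', hG', smul_eq_mul]
  have hN : mink (normalPart (P.A j) (P.A k) (P.A i)) (normalPart (P.A j) (P.A k) (P.A i)) =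
      mink p p := by
    rw [hp, mink_normalPart_normalPart _ _ (P.A_mem j).1 (P.A_mem k).1 (P.mink_A_neg hjk).ne,
      mink_normalPart_normalPart _ _ (hu j) (hu k) hab.ne]
    simp only [hG]
  have hN' : mink (normalPart (P'.A j') (P'.A k') (P'.A i'))
      (normalPart (P'.A j') (P'.A k') (P'.A i')) = mink p' p' := by
    rw [hp', mink_normalPart_normalPart _ _ (P'.A_mem j').1 (P'.A_mem k').1
      (P'.mink_A_neg hjk').ne, mink_normalPart_normalPart _ _ (hu j) (hu k) hab.ne]
    simp only [hG', hj, hk]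
  have hν := P.mink_normalPart_normal_self_pos hjk
  have hνeq : mink (normalPart (P'.A j') (P'.A k') P'.normal)
      (normalPart (P'.A j') (P'.A k') P'.normal) =
      mink (normalPart (P.A j) (P.A k) P.normal) (normalPart (P.A j) (P.A k) P.normal) := by
    rw [P.mink_normalPart_normal_self hjk, P'.mink_normalPart_normal_self hjk', hhj, hhk, hG, hG',
      hj, hk]
  have hpos' := P'.mink_normalPart_A_pos hij' hik' hjk'
  rw [hN'] at hpos'
  have hsq : Real.sqrt (mink p p) = -μ * Real.sqrt (mink p' p') := by
    rw [hpp', mink_smul_left, mink_smul_right, ← mul_assoc, Real.sqrt_mul (mul_self_nonneg μ),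
      Real.sqrt_mul_self_eq_abs, abs_of_neg hμ]
  rw [SemiIdealPrism.cosExterior, SemiIdealPrism.cosExterior, hνeq, hD, hD', hN, hN', hsq] at hcos
  set N := mink (normalPart (P.A j) (P.A k) P.normal) (normalPart (P.A j) (P.A k) P.normal)
  have hs1 := Real.sqrt_pos.2 hν
  have hs2 := Real.sqrt_pos.2 hpos'
  have hμ' : 0 < -μ := by linarith
  -- The angle condition compares slopes along unit normals. As `p = μ • p'` with `μ < 0`, it
  -- becomes `h p ≤ h' p`, and the functionals agree on the edge.
  have e : h p / (-μ * √(mink p' p') * √N) + h' p' / (√(mink p' p') * √N) =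
      (h p - μ * h' p') / (-μ * √(mink p' p') * √N) := by
    have := hμ.ne
    field_simp
    ring
  rw [e] at hcos
  have hle : h p - μ * h' p' ≤ 0 := by
    by_contra! hlt
    exact absurd (div_pos hlt (by positivity)) (not_lt.2 hcos)
  have hle : h p ≤ h' p := by
    rw [show h' p = μ * h' p' by rw [hpp', map_smul, smul_eq_mul]]
    linarith
  have hjj : h' (u j) = h (u j) := by rw [← hj, hh', hhj, hj, hh]
  have hkk : h' (u k) = h (u k) := by rw [← hk, hh', hhk, hk, hh]
  simp only [hp, normalPart, map_sub, map_smul, hjj, hkk] at hle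
  linarith

/-! ### The tiling of the future cone by the cones over the lifted faces -/

namespace IdealTriangulation

variable {n : ℕ} {S : CuspSurface n} (T : IdealTriangulation S)

theorem vert_mem (f : Fin T.numFaces) (i : Fin 3) : T.vert f i ∈ lightCone 2 := by
  obtain ⟨γ, hγ, h⟩ := T.vert_cusp f i
  rw [h]
  exact (S.isometry γ hγ).map_lightCone (S.horo_mem _)

/-- The translates of the faces in the universal covering. -/
abbrev Tile : Type := S.Γ × Fin T.numFaces

/-- The vertices of a tile, as a basis of Minkowski space. -/
noncomputable def tileBasis (a : T.Tile) : Basis (Fin 3) ℝ (Mink 2) :=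
  (basisOfLinearIndependentOfCardEqFinrank (T.nondegenerate a.2) (by simp)).map
    (a.1 : Mink 2 ≃ₗ[ℝ] Mink 2)

variable {T}

theorem tileBasis_apply (a : T.Tile) (i : Fin 3) :
    T.tileBasis a i = (a.1 : Mink 2 ≃ₗ[ℝ] Mink 2) (T.vert a.2 i) := by
  simp [tileBasis]

theorem tileBasis_mem (a : T.Tile) (i : Fin 3) : T.tileBasis a i ∈ lightCone 2 := by
  rw [tileBasis_apply]
  exact (S.isometry _ a.1.2).map_lightCone (T.vert_mem _ _)

theorem mink_tileBasis (a : T.Tile) (i j : Fin 3) :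
    mink (T.tileBasis a i) (T.tileBasis a j) = mink (T.vert a.2 i) (T.vert a.2 j) := by
  rw [tileBasis_apply, tileBasis_apply, (S.isometry _ a.1.2).1]

theorem tile_mem_futureCone (a : T.Tile) (x : Mink 2) (hx : ∀ i, 0 < (T.tileBasis a).coord i x) :
    x ∈ futureCone 2 := by
  rw [← (T.tileBasis a).sum_repr x]
  exact sum_smul_mem_futureCone (tileBasis_mem a) (T.tileBasis a).linearIndependent hx

/-- The rays of a tile are light-like, so inside the future cone tiles meet only along walls. -/
theorem tile_coord_ne_zero (a : T.Tile) (x : Mink 2) (hx : x ∈ futureCone 2) (i j : Fin 3)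
    (hij : i ≠ j) (hi : (T.tileBasis a).coord i x = 0) : (T.tileBasis a).coord j x ≠ 0 := by
  intro hj
  obtain ⟨k, hik, hjk⟩ : ∃ k, i ≠ k ∧ j ≠ k := by
    clear * -; revert i j; decide
  have h := hx.1
  rw [eq_coord_add (T.tileBasis a) hij hik hjk x, hi, hj, zero_smul, zero_smul, zero_add, zero_add,
    mink_smul_left, mink_smul_right, (tileBasis_mem a k).1] at h
  simp at h

theorem tile_cover (x : Mink 2) (hx : x ∈ futureCone 2) :
    ∃ a, ∀ i, 0 ≤ (T.tileBasis a).coord i x := by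
  obtain ⟨s, hs, hsx⟩ := exists_smul_mem_hyp hx
  obtain ⟨γ, hγ, f, -, c, hc, hsum⟩ := T.cover _ hsx
  let a : T.Tile := (⟨γ, hγ⟩⁻¹, f)
  refine ⟨a, fun i => ?_⟩
  have e : s • x = ∑ i, c i • T.tileBasis a i := by
    have : s • x = γ.symm (γ (s • x)) := (γ.symm_apply_apply _).symm
    rw [this, hsum, map_sum]
    refine Finset.sum_congr rfl fun i _ => ?_
    rw [map_smul, tileBasis_apply]
    rfl
  have h : (T.tileBasis a).coord i (s • x) = c i := by
    rw [e, Basis.coord_apply, Basis.repr_sum_self]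
  rw [map_smul, smul_eq_mul] at h
  exact nonneg_of_mul_nonneg_right (h ▸ hc i) hs

theorem mem_idealTriangleInterior (a : T.Tile) (x : Mink 2) (hx : x ∈ hyp 2)
    (hpos : ∀ i, 0 < (T.tileBasis a).coord i x) :
    (a.1 : Mink 2 ≃ₗ[ℝ] Mink 2).symm x ∈ idealTriangleInterior (T.vert a.2) := by
  refine ⟨(S.isometry _ (a.1⁻¹).2).2 x hx, fun i => (T.tileBasis a).coord i x, hpos, ?_⟩
  rw [LinearEquiv.symm_apply_eq, map_sum]
  conv_lhs => rw [← (T.tileBasis a).sum_repr x]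
  refine Finset.sum_congr rfl fun i _ => ?_
  rw [map_smul, tileBasis_apply]
  rfl

theorem tile_disjoint (a c : T.Tile) (x : Mink 2) (hx : x ∈ futureCone 2)
    (ha : ∀ i, 0 < (T.tileBasis a).coord i x) (hc : ∀ i, 0 < (T.tileBasis c).coord i x) :
    a = c := by
  obtain ⟨s, hs, hsx⟩ := exists_smul_mem_hyp hx
  have key := fun d (hd : ∀ i, 0 < (T.tileBasis d).coord i x) =>
    mem_idealTriangleInterior d _ hsx fun i => by
      rw [map_smul, smul_eq_mul]
      exact mul_pos hs (hd i)
  have h := T.disjoint a.2 c.2 (c.1⁻¹ * a.1 : S.Γ) (c.1⁻¹ * a.1).2 _ (key a ha) (by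
    have e : ((c.1⁻¹ * a.1 : S.Γ) : Mink 2 ≃ₗ[ℝ] Mink 2)
        ((a.1 : Mink 2 ≃ₗ[ℝ] Mink 2).symm (s • x)) =
        (c.1 : Mink 2 ≃ₗ[ℝ] Mink 2).symm (s • x) :=
      congrArg (c.1 : Mink 2 ≃ₗ[ℝ] Mink 2).symm ((a.1 : Mink 2 ≃ₗ[ℝ] Mink 2).apply_symm_apply _)
    rw [e]
    exact key c hc)
  refine Prod.ext ?_ h.2
  have h1 : c.1⁻¹ * a.1 = 1 := Subtype.ext h.1
  exact (inv_mul_eq_one.1 h1).symm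

theorem exists_adjacent_tile (a : T.Tile) {j k : Fin 3} (hjk : j ≠ k) :
    ∃ (c : T.Tile) (i' j' k' : Fin 3), i' ≠ j' ∧ i' ≠ k' ∧ j' ≠ k' ∧ c ≠ a ∧
      T.tileBasis c j' = T.tileBasis a j ∧ T.tileBasis c k' = T.tileBasis a k ∧
      T.Glued a.2 j k c.2 j' k' := by
  obtain ⟨γ, f⟩ := a
  obtain ⟨⟨σ, f', j', k'⟩, ⟨hne, hj, hk⟩, -⟩ := T.sides f j k hjk
  have hinj := (T.nondegenerate f).injective
  have hjk' : j' ≠ k' := by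
    rintro rfl
    exact hjk (hinj (hj.symm.trans hk))
  obtain ⟨i', hij', hik'⟩ : ∃ i', i' ≠ j' ∧ i' ≠ k' := by
    clear * -; revert j' k'; decide
  refine ⟨(γ * σ, f'), i', j', k', hij', hik', hjk', ?_, ?_, ?_, hjk, σ, hne, hj, hk⟩
  -- Two sides of one and the same tile cannot have the same ends, so the new side belongs to
  -- another tile.
  · intro h
    obtain ⟨h1, h2⟩ := Prod.ext_iff.1 h
    obtain rfl : σ = 1 := mul_eq_left.1 h1
    obtain rfl : f' = f := h2
    have ej : j' = j := hinj hj
    have ek : k' = k := hinj hk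
    exact hne (by rw [ej, ek])
  · rw [tileBasis_apply, tileBasis_apply]
    exact congrArg (γ : Mink 2 ≃ₗ[ℝ] Mink 2) hj
  · rw [tileBasis_apply, tileBasis_apply]
    exact congrArg (γ : Mink 2 ≃ₗ[ℝ] Mink 2) hk

end IdealTriangulation

/-! ### Height functionals of a convex complex -/

namespace PrismaticComplex

open IdealTriangulation

variable {n : ℕ} {S : CuspSurface n} {T : IdealTriangulation S} {r : Fin n → ℝ}
  (K : PrismaticComplex T r)

/-- Edge lengths determine Gram matrices, since `log` is injective on positive numbers and products
of distinct vertices are negative. -/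
theorem mink_A_eq (f : Fin T.numFaces) (j k : Fin 3) :
    mink ((K.prism f).A j) ((K.prism f).A k) = mink (T.vert f j) (T.vert f k) := by
  by_cases hjk : j = k
  · rw [hjk, ((K.prism f).A_mem k).1, (T.vert_mem f k).1]
  have h := K.upperLength_eq f j k hjk
  have h1 := (K.prism f).mink_A_neg hjk
  have h2 := mink_neg_of_linearIndependent (T.vert_mem f) (T.nondegenerate f) hjk
  have := Real.log_injOn_pos (Set.mem_Ioi.2 (by linarith)) (Set.mem_Ioi.2 (by linarith)) h
  linarith

theorem height_eq_of_glued {f f' : Fin T.numFaces} {j k j' k' : Fin 3}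
    (h : T.Glued f j k f' j' k') :
    (K.prism f').height j' = (K.prism f).height j ∧
      (K.prism f').height k' = (K.prism f).height k := by
  have hg := (K.glue_isometry _ _ _ _ _ _ h).1
  have hu := K.glue_upper _ _ _ _ _ _ h
  have hl := K.glue_lower _ _ _ _ _ _ h
  constructor
  · have := hg ((K.prism f).B j) ((K.prism f).A j)
    rw [hu.1, hl.1, SemiIdealPrism.mink_B_A, SemiIdealPrism.mink_B_A] at this
    linarith
  · have := hg ((K.prism f).B k) ((K.prism f).A k)
    rw [hu.2, hl.2, SemiIdealPrism.mink_B_A, SemiIdealPrism.mink_B_A] at this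
    linarith

/-- The linear functional that gives the hyperbolic sine of the distance to the lower plane on
a tile. -/
noncomputable def tileHeight (a : T.Tile) : Mink 2 →ₗ[ℝ] ℝ :=
  (T.tileBasis a).constr ℝ (K.prism a.2).height

theorem tileHeight_basis (a : T.Tile) (i : Fin 3) :
    K.tileHeight a (T.tileBasis a i) = (K.prism a.2).height i :=
  (T.tileBasis a).constr_basis ℝ _ i

theorem tileHeight_apply (a : T.Tile) (x : Mink 2) :
    K.tileHeight a x = ∑ i, (T.tileBasis a).coord i x * (K.prism a.2).height i := by
  rw [tileHeight, Basis.constr_apply_fintype]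
  rfl

theorem exists_tileHeight_le (hK : K.IsConvex) (a : T.Tile) {x : Mink 2}
    (hx : x ∈ futureCone 2) :
    ∃ c, (∀ i, 0 ≤ (T.tileBasis c).coord i x) ∧ K.tileHeight c x ≤ K.tileHeight a x := by
  refine exists_tile_le (b := T.tileBasis) (h := K.tileHeight) convex_futureCone tile_cover
    tile_mem_futureCone tile_disjoint tile_coord_ne_zero (fun a i j k hij hik hjk => ?_) a hx
  obtain ⟨c, i', j', k', hij', hik', hjk', hca, hj, hk, hglue⟩ := exists_adjacent_tile a hjk
  obtain ⟨hhj, hhk⟩ := K.height_eq_of_glued hglue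
  refine ⟨c, i', j', k', hij', hik', hjk', hca, hj, hk, ?_, ?_, fun hneg => ?_⟩
  · rw [tileHeight_basis, tileHeight_basis, hhj]
  · rw [tileHeight_basis, tileHeight_basis, hhk]
  · exact height_le_of_cosExterior (fun i => (tileBasis_mem a i).1)
      (fun i j => by rw [mink_tileBasis, K.mink_A_eq])
      (fun i j => by rw [mink_tileBasis, K.mink_A_eq])
      (K.tileHeight_basis a) (K.tileHeight_basis c) hjk hij' hik' hjk' hj hk hhj hhk hneg
      (eq_coord_add (T.tileBasis c) hij' hik' hjk' _)
      (SemiIdealPrism.cosExterior_add_le hij hik hjk hij' hik' hjk'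
        (hK _ i _ _ _ i' _ _ hij hik hij' hik' hglue))

theorem exists_height_bound : ∃ w : ℝ, 0 < w ∧ ∀ f i, w ≤ (K.prism f).height i := by
  rcases isEmpty_or_nonempty (Fin T.numFaces) with h | h
  · exact ⟨1, one_pos, fun f => isEmptyElim f⟩
  obtain ⟨p, hp⟩ := Finite.exists_min fun p : Fin T.numFaces × Fin 3 => (K.prism p.1).height p.2
  exact ⟨_, (K.prism p.1).height_pos p.2, fun f i => hp (f, i)⟩

theorem exists_mink_vert_bound (T : IdealTriangulation S) :
    ∃ M : ℝ, 0 < M ∧ ∀ f i j, -mink (T.vert f i) (T.vert f j) ≤ M := by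
  obtain ⟨M, hM⟩ := (Set.finite_range fun p : Fin T.numFaces × Fin 3 × Fin 3 =>
    -mink (T.vert p.1 p.2.1) (T.vert p.1 p.2.2)).bddAbove
  refine ⟨max M 1, by positivity, fun f i j => ?_⟩
  exact (hM ⟨(f, i, j), rfl⟩).trans (le_max_left _ _)

/-- In a convex complex, the distance of the upper surface to the lower boundary is bounded below,
and the continuation of each upper face is above the upper surface. -/
theorem exists_tileHeight_bound (hK : K.IsConvex) : ∃ δ : ℝ, 0 < δ ∧
    ∀ a, ∀ x ∈ futureCone 2, 0 ≤ K.tileHeight a x ∧ δ * -mink x x ≤ K.tileHeight a x ^ 2 := by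
  obtain ⟨w, hw, hwle⟩ := K.exists_height_bound
  obtain ⟨M, hM, hMle⟩ := exists_mink_vert_bound T
  -- If `s` is the sum of the coordinates of `x` in a tile containing it, the height there is at
  -- least `w s`, while `-⟨x,x⟩ ≤ M s²`.
  refine ⟨w ^ 2 / M, by positivity, fun a x hx => ?_⟩
  obtain ⟨c, hc, hle⟩ := K.exists_tileHeight_le hK a hx
  set t : Fin 3 → ℝ := fun i => (T.tileBasis c).coord i x with ht
  have hsum : 0 ≤ ∑ i, t i := Finset.sum_nonneg fun i _ => hc i
  have h1 : w * ∑ i, t i ≤ K.tileHeight c x := by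
    rw [tileHeight_apply, Finset.mul_sum]
    refine Finset.sum_le_sum fun i _ => ?_
    rw [mul_comm]
    exact mul_le_mul_of_nonneg_left (hwle _ _) (hc i)
  have h2 : -mink x x ≤ M * (∑ i, t i) ^ 2 := by
    conv_lhs => rw [← (T.tileBasis c).sum_repr x]
    rw [mink_sum_smul_self, sq, Finset.sum_mul_sum, Finset.mul_sum, ← Finset.sum_neg_distrib]
    refine Finset.sum_le_sum fun i _ => ?_
    rw [Finset.mul_sum, ← Finset.sum_neg_distrib]
    refine Finset.sum_le_sum fun j _ => ?_
    rw [mink_tileBasis, ← mul_neg, mul_comm M]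
    exact mul_le_mul_of_nonneg_left (hMle _ _ _) (mul_nonneg (hc i) (hc j))
  have h3 := mul_nonneg hw.le hsum
  refine ⟨h3.trans (h1.trans hle), ?_⟩
  calc w ^ 2 / M * -mink x x ≤ w ^ 2 / M * (M * (∑ i, t i) ^ 2) :=
        mul_le_mul_of_nonneg_left h2 (by positivity)
    _ = (w * ∑ i, t i) ^ 2 := by field_simp
    _ ≤ K.tileHeight a x ^ 2 := pow_le_pow_left₀ h3 (h1.trans hle) 2

theorem tileHeight_ne_zero (hK : K.IsConvex) (a : T.Tile) {x : Mink 2} (hx : mink x x ≤ 0)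
    (hx0 : 0 < x 0) : K.tileHeight a x ≠ 0 := by
  intro h0
  obtain ⟨δ, hδ, hbound⟩ := K.exists_tileHeight_bound hK
  rcases hx.lt_or_eq with hlt | heq
  · have h := (hbound a x ⟨hlt, hx0⟩).2
    rw [h0] at h
    have := mul_pos hδ (show 0 < -mink x x by linarith)
    linarith
  obtain ⟨o, ho⟩ := exists_mem_futureCone (n := 2)
  have hxo := mink_neg_of_future hx hx0 ho
  set q := mink x o
  -- This is the bound at `x + e • o`, divided by `e`; it fails for small `e`.
  have key : ∀ e : ℝ, 0 < e → 2 * δ * -q < e * K.tileHeight a o ^ 2 := by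
    intro e he
    have hself : mink (x + e • o) (x + e • o) = 2 * e * q + e ^ 2 * mink o o := by
      simp only [mink_add_left, mink_add_right, mink_smul_left, mink_smul_right, heq, mink_comm o x]
      ring
    have h1 := mul_neg_of_pos_of_neg he hxo
    have h2 := mul_neg_of_pos_of_neg (pow_pos he 2) ho.1
    have h := (hbound a (x + e • o) ⟨by rw [hself]; linarith, by
      have := mul_pos he ho.2
      simp only [Pi.add_apply, Pi.smul_apply, smul_eq_mul]
      linarith⟩).2
    rw [hself, map_add, map_smul, h0, zero_add, smul_eq_mul] at h
    have h3 := mul_neg_of_pos_of_neg hδ h2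
    have h4 : e * (2 * δ * -q) < e * (e * K.tileHeight a o ^ 2) := by
      linear_combination h + h3
    exact lt_of_mul_lt_mul_left h4 he.le
  have hH : 0 ≤ K.tileHeight a o ^ 2 := sq_nonneg _
  have hc : 0 < 2 * δ * -q := mul_pos (by positivity) (by linarith)
  have h5 := key (2 * δ * -q / (K.tileHeight a o ^ 2 + 1)) (by positivity)
  rw [div_mul_eq_mul_div, lt_div_iff₀ (by positivity)] at h5
  linarith

end PrismaticComplex

end HypPrism

theorem lemma3p6 {n : ℕ} (S : HypPrism.CuspSurface n) (T : HypPrism.IdealTriangulation S)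
    (r : Fin n → ℝ) (K : HypPrism.PrismaticComplex T r) (hK : K.IsConvex)
    (f : Fin T.numFaces) : (K.prism f).IsUltraparallel := by
  intro x hx hxspan h0
  obtain ⟨c, rfl⟩ := (Submodule.mem_span_range_iff_exists_fun ℝ).1 hxspan
  let a : T.Tile := (1, f)
  -- The point `z` is the image of `x` under the isometry sending each `Aᵢ` to the corresponding
  -- vertex of the face.
  set z : HypPrism.Mink 2 := ∑ i, c i • T.tileBasis a i with hz
  have hzz : HypPrism.mink z z ≤ 0 := by
    have e : HypPrism.mink z z = HypPrism.mink (∑ i, c i • (K.prism f).A i)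
        (∑ i, c i • (K.prism f).A i) := by
      rw [hz, HypPrism.mink_sum_smul_self, HypPrism.mink_sum_smul_self]
      simp only [HypPrism.IdealTriangulation.mink_tileBasis, K.mink_A_eq, a]
    rw [e]
    rcases hx with h | h
    · rw [h.1]
      norm_num
    · exact h.1.le
  have hheight : K.tileHeight a z = 0 := by
    rw [hz, map_sum, ← h0, HypPrism.mink_sum_left]
    refine Finset.sum_congr rfl fun i _ => ?_
    rw [map_smul, K.tileHeight_basis, HypPrism.mink_smul_left]
    rfl
  -- Equality of Gram matrices gives no time orientation directly, so `-z` is treated too.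
  rcases lt_trichotomy (z 0) 0 with h | h | h
  · refine K.tileHeight_ne_zero hK a (x := -z) ?_ (by simpa using h)
      (by rw [map_neg, hheight, neg_zero])
    rw [HypPrism.mink_neg_left, HypPrism.mink_neg_right, neg_neg]
    exact hzz
  · have hz0 := HypPrism.mink_eq_zero_iff_of_nonpos hzz h
    have hc : ∀ i, c i = 0 :=
      Fintype.linearIndependent_iff.1 (T.tileBasis a).linearIndependent c hz0
    have hpos : 0 < (∑ i, c i • (K.prism f).A i) 0 := hx.elim (fun h => h.2) fun h => h.2
    simp [hc] at hpos
  · exact K.tileHeight_ne_zero hK a hzz h hheight
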